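/- Let $K$ be a field and let $E=(E^0,E^1,s,r)$ be a finite directed graph with Leavitt path algebra $L=L_K(E)$. A closed path is a path $c=e_1\cdots e_t$ ($t\ge 1$) with $r(e_t)=s(e_1)$; it is called simple if $c\ne\beta^m$ for every closed path $\beta$ and every $m\ge 2$; and $c^\infty$ denotes the infinite path $ccc\cdots$. Two infinite paths are tail equivalent, $p\sim q$, if they become equal after deleting suitable finite initial segments; $p$ is rational if $p\sim c^\infty$ for some closed path $c$, and irrational otherwise. For an infinite path $p$, $V_{[p]}$ is the left $L$-module with $K$-basis the tail equivalence class $[p]$, on which a vertex $v$ fixes the paths with source $v$ and kills the others, an edge $e$ sends $q$ to $eq$ if $r(e)=s(q)$ and to $0$ otherwise, and $e^*$ deletes the first edge of $q$ if this edge is $e$ and sends $q$ to $0$ otherwise. For a sink $w$ write $V_{[w^\infty]}=Lw$. The Chen simple modules are the modules $V_{[p]}$ for infinite paths $p$ and $V_{[w^\infty]}$ for sinks $w$. Let $d$ be a simple closed path in $E$, and for an infinite path $q$ let $L_{(d,q)}$ be the set of infinite paths $p\sim q$ with $s(p)=s(d)$ that are not of the form $dp'$ with $p'$ an infinite path. Then: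 1. If $T$ is a Chen simple module such that $\operatorname{Ext}^1_L(V_{[d^\infty]},T)$ is nonzero and finite-dimensional over $K$, then $T=V_{[c^\infty]}$, where $c$ is a simple closed path or a sink. In particular, if $T=V_{[q]}$ for an infinite path $q$, then $q\sim c^\infty$ for some simple closed path $c$. 2. If $q$ is an irrational infinite path and $L_{(d,q)}$ is nonempty, then $L_{(d,q)}$ is infinite. 3. If $L_{(d,d^\infty)}$ is nonempty, then it is infinite. -/

import Mathlib

open CategoryTheory

universe u v

/-- A directed graph `E = (E⁰, E¹, s, r)`. Multiple edges and loops are allowed. -/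
structure DirectedGraph where
  /-- the vertices -/
  V : Type v
  /-- the edges -/
  E : Type v
  /-- the source of an edge -/
  s : E → V
  /-- the range of an edge -/
  r : E → V

namespace DirectedGraph

/-- A vertex that emits no edge. -/
def IsSink (G : DirectedGraph.{v}) (w : G.V) : Prop := ∀ e : G.E, G.s e ≠ w

/-- An infinite path `e₀ e₁ e₂ ⋯`. -/
@[ext]
structure InfPath (G : DirectedGraph.{v}) where
  /-- the sequence of edges -/
  edge : ℕ → G.E
  /-- consecutive edges match -/
  compat : ∀ n, G.s (edge (n + 1)) = G.r (edge n)

/-- A closed path `e₁ ⋯ eₜ` of positive length. -/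
structure ClosedPath (G : DirectedGraph.{v}) where
  /-- the list of edges -/
  edges : List G.E
  /-- the length is positive -/
  ne_nil : edges ≠ []
  /-- consecutive edges match -/
  chain : edges.IsChain (fun e f => G.r e = G.s f)
  /-- the path ends where it starts -/
  closed : G.r (edges.getLast ne_nil) = G.s (edges.head ne_nil)

variable {G : DirectedGraph.{v}}

namespace InfPath

/-- The source of an infinite path. -/
def src (p : G.InfPath) : G.V := G.s (p.edge 0)

/-- The infinite path obtained by deleting the first edge. -/
def tail (p : G.InfPath) : G.InfPath where
  edge n := p.edge (n + 1)
  compat n := p.compat (n + 1)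

/-- The infinite path `e p`. -/
def cons (e : G.E) (p : G.InfPath) (h : G.r e = p.src) : G.InfPath where
  edge n := Nat.casesOn n e p.edge
  compat n := by
    cases n with
    | zero => exact h.symm
    | succ n => exact p.compat n

/-- Tail equivalence: deleting `m` edges from `p` and `n` edges from `q` gives the same path. -/
def TailEquiv (p q : G.InfPath) : Prop := ∃ m n : ℕ, ∀ k, p.edge (m + k) = q.edge (n + k)

/-- Tail equivalence as a setoid. -/
instance tailSetoid (G : DirectedGraph.{v}) : Setoid G.InfPath where
  r := TailEquiv
  iseqv :=
    { refl := fun _ => ⟨0, 0, fun _ => rfl⟩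
      symm := fun ⟨m, n, h⟩ => ⟨n, m, fun k => (h k).symm⟩
      trans := by
        rintro p q t ⟨m, n, h⟩ ⟨a, b, h'⟩
        refine ⟨m + a, b + n, fun k => ?_⟩
        have h1 := h (a + k)
        have h2 := h' (n + k)
        rw [show m + a + k = m + (a + k) by ring, h1,
          show n + (a + k) = a + (n + k) by ring, h2, show b + n + k = b + (n + k) by ring] }

theorem tail_equiv (p : G.InfPath) : p.tail ≈ p :=
  ⟨0, 1, fun k => by simp only [tail]; congr 1; ring⟩

theorem cons_equiv (e : G.E) (p : G.InfPath) (h : G.r e = p.src) : cons e p h ≈ p :=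
  ⟨1, 0, fun k => by rw [add_comm 1 k, zero_add]; rfl⟩

theorem src_cons (e : G.E) (p : G.InfPath) (h : G.r e = p.src) : (cons e p h).src = G.s e := rfl

theorem src_tail (p : G.InfPath) : p.tail.src = G.r (p.edge 0) := p.compat 0

theorem tail_cons (e : G.E) (p : G.InfPath) (h : G.r e = p.src) : (cons e p h).tail = p := rfl

theorem cons_tail (p : G.InfPath) : cons (p.edge 0) p.tail p.src_tail.symm = p := by
  ext n
  cases n <;> rfl

end InfPath

namespace ClosedPath

/-- The vertex at which a closed path starts and ends. -/
def src (c : G.ClosedPath) : G.V := G.s (c.edges.head c.ne_nil)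

/-- A closed path is simple if it is not a power `β ^ m`, `m ≥ 2`, of a closed path `β`. -/
def IsSimple (c : G.ClosedPath) : Prop :=
  ∀ (b : G.ClosedPath) (m : ℕ), 2 ≤ m → c.edges ≠ (List.replicate m b.edges).flatten

theorem length_pos (c : G.ClosedPath) : 0 < c.edges.length :=
  List.length_pos_of_ne_nil c.ne_nil

/-- The infinite path `c^∞ = c c c ⋯`. -/
def inf (c : G.ClosedPath) : G.InfPath where
  edge n := c.edges[n % c.edges.length]'(Nat.mod_lt _ c.length_pos)
  compat n := by
    have hpos := c.length_pos
    have hlt := Nat.mod_lt n hpos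
    rcases Nat.lt_or_ge (n % c.edges.length + 1) c.edges.length with h | h
    · have h1 : (n + 1) % c.edges.length = n % c.edges.length + 1 := by
        rw [← Nat.mod_add_mod, Nat.mod_eq_of_lt h]
      simp only [h1]
      exact ((List.isChain_iff_getElem.mp c.chain) _ h).symm
    · have h2 : n % c.edges.length = c.edges.length - 1 := by omega
      have h1 : (n + 1) % c.edges.length = 0 := by
        rw [← Nat.mod_add_mod, h2, Nat.sub_add_cancel hpos, Nat.mod_self]
      have h3 := c.closed
      rw [List.getLast_eq_getElem, List.head_eq_getElem] at h3
      simp only [h1, h2]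
      exact h3.symm

end ClosedPath

/-- An infinite path is rational if it is tail equivalent to some `c^∞`. -/
def InfPath.IsRational (p : G.InfPath) : Prop := ∃ c : G.ClosedPath, p ≈ c.inf

/-- `p` is divisible by `d` if `p = d p'` for an infinite path `p'`. -/
def InfPath.DivisibleBy (p : G.InfPath) (d : G.ClosedPath) : Prop :=
  ∃ p' : G.InfPath, (∀ (i : ℕ) (h : i < d.edges.length), p.edge i = d.edges[i]) ∧
    ∀ k, p.edge (d.edges.length + k) = p'.edge k

/-- The set `L_{(d,q)}` of the infinite paths that are tail equivalent to `q`, start at the source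
of `d`, and are not divisible by `d`. -/
def LSet (d : G.ClosedPath) (q : G.InfPath) : Set G.InfPath :=
  {p | p ≈ q ∧ p.src = d.src ∧ ¬ p.DivisibleBy d}

/-- The generators `v`, `e`, `e*` of the Leavitt path algebra. -/
inductive LGen (G : DirectedGraph.{v}) : Type v
  | vert (w : G.V) : LGen G
  | edge (e : G.E) : LGen G
  | ghost (e : G.E) : LGen G

open LGen in
open scoped Classical in
/-- The defining relations (V), (E1), (E2), (CK1), (CK2) of the Leavitt path algebra of a finite
graph. The relation `one` says that the unit is the sum of the vertices: as there are finitely many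
vertices, this sum is the unit of the algebra presented without a unit by the other relations. -/
inductive LRel (K : Type u) [Field K] (G : DirectedGraph.{v}) [Fintype G.V] [Fintype G.E] :
    FreeAlgebra K (LGen G) → FreeAlgebra K (LGen G) → Prop
  | vert_self (w : G.V) :
      LRel K G (FreeAlgebra.ι K (vert w) * FreeAlgebra.ι K (vert w)) (FreeAlgebra.ι K (vert w))
  | vert_ne (w x : G.V) (h : w ≠ x) :
      LRel K G (FreeAlgebra.ι K (vert w) * FreeAlgebra.ι K (vert x)) 0
  | src_edge (e : G.E) :
      LRel K G (FreeAlgebra.ι K (vert (G.s e)) * FreeAlgebra.ι K (edge e))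
        (FreeAlgebra.ι K (edge e))
  | edge_rng (e : G.E) :
      LRel K G (FreeAlgebra.ι K (edge e) * FreeAlgebra.ι K (vert (G.r e)))
        (FreeAlgebra.ι K (edge e))
  | rng_ghost (e : G.E) :
      LRel K G (FreeAlgebra.ι K (vert (G.r e)) * FreeAlgebra.ι K (ghost e))
        (FreeAlgebra.ι K (ghost e))
  | ghost_src (e : G.E) :
      LRel K G (FreeAlgebra.ι K (ghost e) * FreeAlgebra.ι K (vert (G.s e)))
        (FreeAlgebra.ι K (ghost e))
  | ck1_self (e : G.E) :
      LRel K G (FreeAlgebra.ι K (ghost e) * FreeAlgebra.ι K (edge e))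
        (FreeAlgebra.ι K (vert (G.r e)))
  | ck1_ne (e f : G.E) (h : e ≠ f) :
      LRel K G (FreeAlgebra.ι K (ghost e) * FreeAlgebra.ι K (edge f)) 0
  | ck2 (w : G.V) (h : ¬ G.IsSink w) :
      LRel K G (FreeAlgebra.ι K (vert w))
        (∑ e : G.E with G.s e = w, FreeAlgebra.ι K (edge e) * FreeAlgebra.ι K (ghost e))
  | one : LRel K G 1 (∑ w : G.V, FreeAlgebra.ι K (vert w))

/-- The Leavitt path algebra `L_K(E)` of a finite graph. -/
abbrev LPA (K : Type u) [Field K] (G : DirectedGraph.{v}) [Fintype G.V] [Fintype G.E] :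
    Type (max u v) :=
  RingQuot (LRel K G)

/-- A vertex as an element of the Leavitt path algebra. -/
noncomputable def LPA.vert (K : Type u) [Field K] {G : DirectedGraph.{v}} [Fintype G.V]
    [Fintype G.E] (w : G.V) : LPA K G :=
  RingQuot.mkAlgHom K (LRel K G) (FreeAlgebra.ι K (LGen.vert w))

/-- A tail equivalence class `[p]` of infinite paths. -/
abbrev TailClass (G : DirectedGraph.{v}) : Type v := Quotient (InfPath.tailSetoid G)

/-- The members of a tail equivalence class. -/
abbrev TailClass.Mem (ξ : G.TailClass) : Type v := {q : G.InfPath // (⟦q⟧ : G.TailClass) = ξ}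

/-- The vector space `V_{[p]}` with basis the class `[p]`. -/
def ChenSpace (K : Type u) [Field K] (ξ : G.TailClass) : Type (max u v) := ξ.Mem →₀ K

namespace ChenSpace

noncomputable instance (K : Type u) [Field K] (ξ : G.TailClass) : AddCommGroup (ChenSpace K ξ) :=
  inferInstanceAs (AddCommGroup (ξ.Mem →₀ K))

noncomputable instance (K : Type u) [Field K] (ξ : G.TailClass) : Module K (ChenSpace K ξ) :=
  inferInstanceAs (Module K (ξ.Mem →₀ K))

variable (K : Type u) [Field K] {ξ : G.TailClass}

/-- The basis vector of `V_{[p]}` given by a path in `[p]`. -/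
noncomputable def path (q : ξ.Mem) : ChenSpace K ξ := Finsupp.single q (1 : K)

open scoped Classical in
/-- The action of a generator on a basis vector of `V_{[p]}`. -/
noncomputable def genPath (ξ : G.TailClass) : LGen G → ξ.Mem → ChenSpace K ξ
  | .vert w, q => if w = q.1.src then path K q else 0
  | .edge e, q =>
      if h : G.r e = q.1.src then
        path K ⟨q.1.cons e h, (Quotient.sound (q.1.cons_equiv e h)).trans q.2⟩
      else 0
  | .ghost e, q =>
      if e = q.1.edge 0 then
        path K ⟨q.1.tail, (Quotient.sound q.1.tail_equiv).trans q.2⟩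
      else 0

/-- The action of a generator on `V_{[p]}`. -/
noncomputable def gen (ξ : G.TailClass) (x : LGen G) : Module.End K (ChenSpace K ξ) :=
  Finsupp.linearCombination K (genPath K ξ x)

theorem gen_path (x : LGen G) (q : ξ.Mem) : gen K ξ x (path K q) = genPath K ξ x q :=
  (Finsupp.linearCombination_single K (1 : K) q).trans (one_smul K _)

theorem end_ext {f g : Module.End K (ChenSpace K ξ)} (h : ∀ q, f (path K q) = g (path K q)) :
    f = g :=
  Finsupp.lhom_ext' fun q => LinearMap.ext_ring (h q)

theorem gen_vert (w : G.V) (q : ξ.Mem) (h : w = q.1.src) :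
    gen K ξ (.vert w) (path K q) = path K q := by
  rw [gen_path, genPath, if_pos h]

theorem gen_vert_ne (w : G.V) (q : ξ.Mem) (h : ¬ w = q.1.src) :
    gen K ξ (.vert w) (path K q) = 0 := by
  rw [gen_path, genPath, if_neg h]

theorem gen_edge (e : G.E) (q : ξ.Mem) (h : G.r e = q.1.src) :
    gen K ξ (.edge e) (path K q) =
      path K ⟨q.1.cons e h, (Quotient.sound (q.1.cons_equiv e h)).trans q.2⟩ := by
  rw [gen_path, genPath, dif_pos h]

theorem gen_edge_ne (e : G.E) (q : ξ.Mem) (h : ¬ G.r e = q.1.src) :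
    gen K ξ (.edge e) (path K q) = 0 := by
  rw [gen_path, genPath, dif_neg h]

theorem gen_ghost (e : G.E) (q : ξ.Mem) (h : e = q.1.edge 0) :
    gen K ξ (.ghost e) (path K q) =
      path K ⟨q.1.tail, (Quotient.sound q.1.tail_equiv).trans q.2⟩ := by
  rw [gen_path, genPath, if_pos h]

theorem gen_ghost_ne (e : G.E) (q : ξ.Mem) (h : ¬ e = q.1.edge 0) :
    gen K ξ (.ghost e) (path K q) = 0 := by
  rw [gen_path, genPath, if_neg h]

theorem gen_rel [Fintype G.V] [Fintype G.E] {x y : FreeAlgebra K (LGen G)} (h : LRel K G x y) :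
    FreeAlgebra.lift K (gen K ξ) x = FreeAlgebra.lift K (gen K ξ) y := by
  classical
  induction h with
  | vert_self w =>
    simp only [map_mul, FreeAlgebra.lift_ι_apply]
    refine end_ext K fun q => ?_
    by_cases hw : w = q.1.src
    · simp only [Module.End.mul_apply, gen_vert K w q hw]
    · simp only [Module.End.mul_apply, gen_vert_ne K w q hw, map_zero]
  | vert_ne w x hne =>
    simp only [map_mul, map_zero, FreeAlgebra.lift_ι_apply]
    refine end_ext K fun q => ?_
    by_cases hx : x = q.1.src
    · have hw : ¬ w = q.1.src := fun h => hne (h.trans hx.symm)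
      simp only [Module.End.mul_apply, gen_vert K x q hx, gen_vert_ne K w q hw,
        LinearMap.zero_apply]
    · simp only [Module.End.mul_apply, gen_vert_ne K x q hx, map_zero, LinearMap.zero_apply]
  | src_edge e =>
    simp only [map_mul, FreeAlgebra.lift_ι_apply]
    refine end_ext K fun q => ?_
    by_cases hq : G.r e = q.1.src
    · rw [Module.End.mul_apply, gen_edge K e q hq]
      exact gen_vert K _ _ rfl
    · simp only [Module.End.mul_apply, gen_edge_ne K e q hq, map_zero]
  | edge_rng e =>
    simp only [map_mul, FreeAlgebra.lift_ι_apply]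
    refine end_ext K fun q => ?_
    by_cases hq : G.r e = q.1.src
    · rw [Module.End.mul_apply, gen_vert K _ q hq]
    · simp only [Module.End.mul_apply, gen_vert_ne K _ q hq, gen_edge_ne K e q hq, map_zero]
  | rng_ghost e =>
    simp only [map_mul, FreeAlgebra.lift_ι_apply]
    refine end_ext K fun q => ?_
    by_cases hq : e = q.1.edge 0
    · rw [Module.End.mul_apply, gen_ghost K e q hq]
      exact gen_vert K _ _ (by rw [hq]; exact q.1.src_tail.symm)
    · simp only [Module.End.mul_apply, gen_ghost_ne K e q hq, map_zero]
  | ghost_src e =>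
    simp only [map_mul, FreeAlgebra.lift_ι_apply]
    refine end_ext K fun q => ?_
    by_cases hq : G.s e = q.1.src
    · rw [Module.End.mul_apply, gen_vert K _ q hq]
    · have he : ¬ e = q.1.edge 0 := fun h => hq (by rw [h]; rfl)
      simp only [Module.End.mul_apply, gen_vert_ne K _ q hq, gen_ghost_ne K e q he, map_zero]
  | ck1_self e =>
    simp only [map_mul, FreeAlgebra.lift_ι_apply]
    refine end_ext K fun q => ?_
    by_cases hq : G.r e = q.1.src
    · rw [Module.End.mul_apply, gen_edge K e q hq, gen_vert K _ q hq, gen_ghost K e _ rfl]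
      rfl
    · simp only [Module.End.mul_apply, gen_edge_ne K e q hq, gen_vert_ne K _ q hq, map_zero]
  | ck1_ne e f hne =>
    simp only [map_mul, map_zero, FreeAlgebra.lift_ι_apply]
    refine end_ext K fun q => ?_
    by_cases hq : G.r f = q.1.src
    · rw [Module.End.mul_apply, gen_edge K f q hq]
      exact gen_ghost_ne K e _ hne
    · simp only [Module.End.mul_apply, gen_edge_ne K f q hq, map_zero, LinearMap.zero_apply]
  | ck2 w hw =>
    simp only [map_sum, map_mul, FreeAlgebra.lift_ι_apply]
    refine end_ext K fun q => ?_
    have key : ∀ e : G.E, (gen K ξ (.edge e) * gen K ξ (.ghost e)) (path K q) =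
        if e = q.1.edge 0 then path K q else 0 := by
      intro e
      split_ifs with he
      · subst he
        rw [Module.End.mul_apply, gen_ghost K _ q rfl, gen_edge K _ _ q.1.src_tail.symm]
        congr 1
        exact Subtype.ext q.1.cons_tail
      · simp only [Module.End.mul_apply, gen_ghost_ne K e q he, map_zero]
    rw [LinearMap.sum_apply, Finset.sum_congr rfl fun e _ => key e, Finset.sum_ite_eq',
      gen_path, genPath]
    simp only [Finset.mem_filter, Finset.mem_univ, true_and]
    by_cases h : w = q.1.src
    · rw [if_pos h, if_pos (show G.s (q.1.edge 0) = w from h.symm)]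
    · rw [if_neg h, if_neg (show ¬ G.s (q.1.edge 0) = w from fun h' => h (Eq.symm h'))]
  | one =>
    simp only [map_sum, map_one, FreeAlgebra.lift_ι_apply]
    refine end_ext K fun q => ?_
    rw [LinearMap.sum_apply, Finset.sum_congr rfl fun w _ => gen_path K (.vert w) q]
    simp only [genPath, Finset.sum_ite_eq', Finset.mem_univ, if_true, Module.End.one_apply]

/-- The representation of the Leavitt path algebra on `V_{[p]}`: a vertex `w` fixes the paths that
start at `w` and kills the others, an edge `e` sends `q` to `e q` if this is a path and to `0`
otherwise, and `e*` deletes the first edge of `q` if it is `e` and sends `q` to `0` otherwise. -/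
noncomputable def rep (ξ : G.TailClass) [Fintype G.V] [Fintype G.E] :
    LPA K G →ₐ[K] Module.End K (ChenSpace K ξ) :=
  RingQuot.liftAlgHom K ⟨FreeAlgebra.lift K (gen K ξ), fun _ _ h => gen_rel K h⟩

/-- The left module structure on `V_{[p]}` over the Leavitt path algebra. -/
noncomputable instance [Fintype G.V] [Fintype G.E] : Module (LPA K G) (ChenSpace K ξ) :=
  Module.compHom (ChenSpace K ξ) (rep K ξ).toRingHom

end ChenSpace

/-- The labels of the Chen simple modules: a tail equivalence class of infinite paths for `V_{[p]}`
and a sink `w` for `V_{[w^∞]} = L_K(E) w`. -/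
inductive ChenClass (G : DirectedGraph.{v}) : Type v
  | path (ξ : G.TailClass) : ChenClass G
  | sink (w : G.V) (hw : G.IsSink w) : ChenClass G

/-- The Chen simple left module with a given label. -/
noncomputable def chenModule (K : Type u) [Field K] [Fintype G.V] [Fintype G.E] :
    G.ChenClass → ModuleCat.{max u v} (LPA K G)
  | .path ξ => ModuleCat.of (LPA K G) (ChenSpace K ξ)
  | .sink w _ => ModuleCat.of (LPA K G) (Ideal.span {LPA.vert K w} : Ideal (LPA K G))

/-- The label of `V_{[c^∞]}` for a closed path `c`. -/
def ClosedPath.chenClass (c : G.ClosedPath) : G.ChenClass := .path ⟦c.inf⟧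

end DirectedGraph

/-! For a simple closed path `d`, sending `1` to `d^∞` gives a free resolution `0 → L → L →
V_{[d^∞]} → 0` whose first map is right multiplication by `d - 1` (`resolution_shortExact`).
Injectivity comes from the `ℤ`-grading of `L`, and exactness in the middle from an `L`-linear map
`V_{[d^∞]} → L/L(d - 1)` sending `α d^∞` to the class of `α`. Thus `Ext¹(V_{[d^∞]}, T)` is governed
by `T/(d - 1)T`.

Let `T = V_{[q]}` with `q` irrational. If no path in `[q]` starts at the source of `d`, then `d`
kills `T`, so `d - 1` acts as `-1` and Ext vanishes. Otherwise, stripping copies of `d` from such a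
path must stop, because `[q]` does not contain `d^∞`; hence `L_{(d,q)}` is nonempty
(`LSet_nonempty`), and therefore infinite. Its members are linearly independent modulo `(d - 1)T`,
since the functional marking the paths `d^k p₀` kills `(d - 1)T` and detects only `p₀` among them.
So a nonzero Ext would be infinite-dimensional.

Both infinitude statements are combinatorial: a fixed long prefix of one member is put in front of
infinitely many tails, and sharing that prefix prevents divisibility by `d`. -/

namespace DirectedGraph

variable {G : DirectedGraph.{v}}

/-! ### Cutting, splicing and periodicity of infinite paths -/

namespace InfPath

/-- The infinite path obtained by deleting the first `m` edges. -/
def drop (p : G.InfPath) (m : ℕ) : G.InfPath where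
  edge k := p.edge (m + k)
  compat k := p.compat (m + k)

/-- The first `m` edges of `p` followed by `q`. -/
def splice (p : G.InfPath) (m : ℕ) (q : G.InfPath) (h : G.s (p.edge m) = q.src) : G.InfPath where
  edge k := if k < m then p.edge k else q.edge (k - m)
  compat k := by
    rcases lt_trichotomy (k + 1) m with hk | hk | hk
    · rw [if_pos hk, if_pos (by omega)]
      exact p.compat k
    · subst hk
      rw [if_neg (by omega), if_pos (by omega), Nat.sub_self]
      exact h.symm.trans (p.compat k)
    · rw [if_neg (by omega), if_neg (by omega), show k + 1 - m = k - m + 1 by omega]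
      exact q.compat _

theorem splice_edge_lt {p : G.InfPath} {m : ℕ} {q : G.InfPath} (h : G.s (p.edge m) = q.src)
    {k : ℕ} (hk : k < m) : (splice p m q h).edge k = p.edge k := if_pos hk

theorem splice_edge_add {p : G.InfPath} {m : ℕ} {q : G.InfPath} (h : G.s (p.edge m) = q.src)
    (k : ℕ) : (splice p m q h).edge (m + k) = q.edge k := by
  simp [splice]

theorem drop_splice {p : G.InfPath} {m : ℕ} {q : G.InfPath} (h : G.s (p.edge m) = q.src) :
    (splice p m q h).drop m = q := by
  ext k
  exact splice_edge_add h k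

theorem splice_drop (p : G.InfPath) (m : ℕ) (q : G.InfPath) (h : G.s (p.edge m) = q.src)
    (hq : p.drop m = q) : splice p m q h = p := by
  subst hq
  ext k
  rcases lt_or_ge k m with hk | hk
  · exact splice_edge_lt h hk
  · obtain ⟨k, rfl⟩ := Nat.exists_eq_add_of_le hk
    exact splice_edge_add h k

theorem splice_injective {p : G.InfPath} {m : ℕ} {q q' : G.InfPath} (h : G.s (p.edge m) = q.src)
    (h' : G.s (p.edge m) = q'.src) (e : splice p m q h = splice p m q' h') : q = q' := by
  rw [← drop_splice h, e, drop_splice]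

theorem src_splice {p : G.InfPath} {m : ℕ} (hm : 0 < m) {q : G.InfPath}
    (h : G.s (p.edge m) = q.src) : (splice p m q h).src = p.src :=
  congrArg G.s (splice_edge_lt h hm)

theorem drop_equiv (p : G.InfPath) (m : ℕ) : p.drop m ≈ p :=
  ⟨0, m, fun k => by rw [zero_add]; rfl⟩

theorem splice_equiv {p : G.InfPath} {m : ℕ} {q : G.InfPath} (h : G.s (p.edge m) = q.src) :
    splice p m q h ≈ q :=
  ⟨m, 0, fun k => by rw [zero_add, splice_edge_add]⟩

theorem drop_drop (p : G.InfPath) (a b : ℕ) : (p.drop a).drop b = p.drop (a + b) := by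
  ext k
  simp [drop, add_assoc]

theorem drop_zero (p : G.InfPath) : p.drop 0 = p := by
  ext k
  simp [drop]

theorem tail_eq_drop (p : G.InfPath) : p.tail = p.drop 1 := by
  ext k
  simp [drop, tail, add_comm]

theorem divisibleBy_iff (p : G.InfPath) (d : G.ClosedPath) :
    p.DivisibleBy d ↔ ∀ i < d.edges.length, p.edge i = d.inf.edge i := by
  constructor
  · rintro ⟨p', h, -⟩ i hi
    simpa [ClosedPath.inf, Nat.mod_eq_of_lt hi] using h i hi
  · intro h
    refine ⟨p.drop d.edges.length, fun i hi => ?_, fun k => rfl⟩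
    simpa [ClosedPath.inf, Nat.mod_eq_of_lt hi] using h i hi

/-- A periodic infinite path is of the form `c^∞`. -/
theorem exists_closedPath_of_periodic (p : G.InfPath) {t : ℕ} (ht : 0 < t)
    (h : ∀ i, p.edge (i + t) = p.edge i) :
    ∃ c : G.ClosedPath, c.edges = List.ofFn (fun i : Fin t => p.edge i) ∧ c.inf = p := by
  have hne : List.ofFn (fun i : Fin t => p.edge i) ≠ [] := by
    intro h0
    have := congrArg List.length h0
    simp at this
    omega
  refine ⟨⟨List.ofFn (fun i : Fin t => p.edge i), hne, ?_, ?_⟩, rfl, ?_⟩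
  · rw [List.isChain_iff_getElem]
    intro i hi
    simp only [List.getElem_ofFn]
    exact (p.compat i).symm
  · rw [List.getLast_eq_getElem, List.head_eq_getElem]
    simp only [List.getElem_ofFn, List.length_ofFn]
    rw [← p.compat, Nat.sub_add_cancel ht]
    have := h 0
    rw [zero_add] at this
    rw [this]
  · ext i
    simp only [ClosedPath.inf, List.getElem_ofFn, List.length_ofFn]
    have hp : Function.Periodic p.edge t := h
    exact hp.map_mod_nat i

/-- Coinciding tails make the earlier tail periodic with period `k - j`. -/
theorem isRational_of_drop_eq (p : G.InfPath) {j k : ℕ} (hjk : j < k) (h : p.drop j = p.drop k) :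
    p.IsRational := by
  obtain ⟨c, -, hc⟩ := exists_closedPath_of_periodic (p.drop j) (t := k - j) (by omega) (by
    intro i
    have := congrArg (fun x : G.InfPath => x.edge i) h
    simp only [drop] at this ⊢
    rw [this]
    congr 1
    omega)
  exact ⟨c, by rw [hc]; exact Setoid.symm (drop_equiv p j)⟩

theorem isRational_congr {p q : G.InfPath} (h : p ≈ q) (hp : p.IsRational) : q.IsRational :=
  let ⟨c, hc⟩ := hp
  ⟨c, Setoid.trans (Setoid.symm h) hc⟩

end InfPath

open InfPath

/-! ### Periods of `d^∞` and simple closed paths -/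

namespace ClosedPath

theorem inf_periodic (d : G.ClosedPath) : Function.Periodic d.inf.edge d.edges.length := by
  intro i
  simp [inf]

theorem src_inf (d : G.ClosedPath) : d.inf.src = d.src := by
  simp [InfPath.src, inf, src, List.head_eq_getElem]

theorem inf_edge_length_mul (d : G.ClosedPath) (k : ℕ) :
    G.s (d.inf.edge (d.edges.length * k)) = d.src := by
  rw [← src_inf, mul_comm]
  have := d.inf_periodic.nat_mul k 0
  simp only [zero_add, Nat.cast_id] at this
  rw [this]
  rfl

theorem inf_edge_length (d : G.ClosedPath) : G.s (d.inf.edge d.edges.length) = d.src := by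
  simpa using d.inf_edge_length_mul 1

theorem drop_inf (d : G.ClosedPath) (k : ℕ) : d.inf.drop (d.edges.length * k) = d.inf := by
  ext i
  change d.inf.edge _ = _
  rw [add_comm, mul_comm]
  exact d.inf_periodic.nat_mul k i

theorem getElem_flatten_replicate {α : Type*} (l : List α) (m i : ℕ)
    (hi : i < (List.replicate m l).flatten.length) (hl : i % l.length < l.length) :
    (List.replicate m l).flatten[i] = l[i % l.length] := by
  induction m generalizing i with
  | zero => simp at hi
  | succ m ih =>
    simp only [List.replicate_succ, List.flatten_cons, List.getElem_append]
    split_ifs with h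
    · simp [Nat.mod_eq_of_lt h]
    · rw [ih _ _ (Nat.mod_lt _ (by omega))]
      simp [← Nat.mod_eq_sub_mod (not_lt.mp h)]

/-- Every `c^∞` equals `b^∞` for a simple closed path `b`. -/
theorem exists_isSimple (c : G.ClosedPath) : ∃ b : G.ClosedPath, b.IsSimple ∧ b.inf = c.inf := by
  induction hn : c.edges.length using Nat.strong_induction_on generalizing c with
  | _ n ih =>
    by_cases hc : c.IsSimple
    · exact ⟨c, hc, rfl⟩
    · simp only [IsSimple, not_forall, not_not] at hc
      obtain ⟨b, m, hm, h⟩ := hc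
      have hlen : c.edges.length = m * b.edges.length := by simp [h]
      have hb := b.length_pos
      obtain ⟨a, ha, hab⟩ := ih b.edges.length (by nlinarith) b rfl
      refine ⟨a, ha, hab.trans ?_⟩
      ext i
      simp only [inf, h]
      rw [getElem_flatten_replicate _ _ _ _ (Nat.mod_lt _ hb)]
      congr 1
      simp

/-- The periods of `d^∞` for a simple closed path `d` are the multiples of the length of `d`. -/
theorem IsSimple.length_dvd {d : G.ClosedPath} (hd : d.IsSimple) {j : ℕ}
    (h : d.inf.drop j = d.inf) : d.edges.length ∣ j := by
  have hn := d.length_pos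
  have hj : Function.Periodic d.inf.edge j := fun i => by
    have := congrArg (fun x : G.InfPath => x.edge i) h
    rw [add_comm]
    exact this
  -- The least positive period divides every period: a nonzero remainder would be a smaller one.
  obtain ⟨t, hgpos, hgper, hmin⟩ : ∃ t, 0 < t ∧ Function.Periodic d.inf.edge t ∧
      ∀ a, Function.Periodic d.inf.edge a → t ∣ a := by
    classical
    have hex : ∃ t, 0 < t ∧ Function.Periodic d.inf.edge t := ⟨_, hn, d.inf_periodic⟩
    obtain ⟨hgpos, hgper⟩ := Nat.find_spec hex
    refine ⟨_, hgpos, hgper, fun a ha => ?_⟩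
    by_contra hna
    refine Nat.find_min hex (Nat.mod_lt a hgpos)
      ⟨Nat.pos_of_ne_zero fun h0 => hna (Nat.dvd_of_mod_eq_zero h0), fun i => ?_⟩
    rw [← hgper.nat_mul (a / Nat.find hex), ← ha i]
    congr 1
    have := Nat.mod_add_div' a (Nat.find hex)
    simp only [Nat.cast_id]
    omega
  have hmj := hmin j hj
  obtain ⟨m, hm⟩ := hmin _ d.inf_periodic
  obtain ⟨b, hb, -⟩ := exists_closedPath_of_periodic d.inf hgpos hgper
  by_contra hne
  -- If `m = 1`, the length of `d` is the least period, which divides `j`. With `m ≥ 2`, `d` is the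
  -- `m`-th power of its first least period, against simplicity.
  have hm2 : 2 ≤ m := by
    rcases m with _ | _ | m
    · omega
    · refine absurd hmj (fun h => hne ?_)
      rwa [hm, zero_add, mul_one]
    · omega
  refine hd b m hm2 (List.ext_getElem ?_ fun i h1 h2 => ?_)
  · simp [hb, hm, mul_comm]
  · rw [getElem_flatten_replicate _ _ _ _ (Nat.mod_lt _ b.length_pos)]
    simp only [hb, List.getElem_ofFn, List.length_ofFn]
    rw [hgper.map_mod_nat i]
    simp [inf, Nat.mod_eq_of_lt h1]

/-- A path tail equivalent to `d^∞` becomes `d^∞` after deleting a long initial segment. -/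
theorem exists_drop_eq_inf (d : G.ClosedPath) {p : G.InfPath} (h : p ≈ d.inf) (N : ℕ) :
    ∃ m, N ≤ m ∧ p.drop m = d.inf := by
  obtain ⟨a, b, hab⟩ := h
  have hn := d.length_pos
  -- The cut at `a` in `p` matches the cut at `b` in `d^∞`; moving on to a multiple of the period,
  -- of size at least `b + N`, restores the phase and exceeds `N`.
  refine ⟨a + (d.edges.length * (b + N) - b), ?_, ?_⟩
  · have : b + N ≤ d.edges.length * (b + N) := Nat.le_mul_of_pos_left _ hn
    omega
  · ext k
    have hle : b ≤ d.edges.length * (b + N) :=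
      (Nat.le_add_right b N).trans (Nat.le_mul_of_pos_left _ hn)
    simp only [drop]
    rw [add_assoc, hab, show b + (d.edges.length * (b + N) - b + k) =
      k + (b + N) * d.edges.length by rw [mul_comm (b + N)]; omega]
    exact d.inf_periodic.nat_mul (b + N) k

end ClosedPath

/-! ### Infinitude of `L_{(d,q)}` -/

/-- By pigeonhole a member `p` visits some vertex infinitely often. The prefix up to one late visit
can be followed by the tail from any visit, and irrationality makes these tails distinct. -/
theorem LSet_infinite_of_not_isRational [Finite G.V] {d : G.ClosedPath} {q : G.InfPath}
    (hq : ¬ q.IsRational) (hne : (LSet d q).Nonempty) : (LSet d q).Infinite := by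
  obtain ⟨p, hpq, hps, hpd⟩ := hne
  obtain ⟨w, hw⟩ := Finite.exists_infinite_fiber (fun i => G.s (p.edge i))
  have hinf : ((fun i => G.s (p.edge i)) ⁻¹' {w}).Infinite := Set.infinite_coe_iff.mp hw
  -- A prefix longer than `d` already witnesses that the spliced paths are not divisible by `d`.
  obtain ⟨m, hmw, hm⟩ := hinf.exists_gt d.edges.length
  have hsrc : ∀ j : (fun i => G.s (p.edge i)) ⁻¹' {w}, G.s (p.edge m) = (p.drop j).src :=
    fun j => (show _ = w from hmw).trans (show _ = w from j.2).symm
  let f : (fun i => G.s (p.edge i)) ⁻¹' {w} → G.InfPath := fun j => splice p m (p.drop j) (hsrc j)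
  have hf : Function.Injective f := by
    intro i j hij
    have hij' := splice_injective _ _ hij
    have hp : ¬ p.IsRational := fun h => hq (isRational_congr hpq h)
    rcases lt_trichotomy i.1 j.1 with h | h | h
    · exact absurd (isRational_of_drop_eq p h hij') hp
    · exact Subtype.ext h
    · exact absurd (isRational_of_drop_eq p h hij'.symm) hp
  refine (Set.infinite_range_of_injective hf).mono ?_
  rintro _ ⟨j, rfl⟩
  refine ⟨Setoid.trans (splice_equiv _) (Setoid.trans (drop_equiv p _) hpq),
    (src_splice (by omega) _).trans hps, ?_⟩
  rw [divisibleBy_iff] at hpd ⊢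
  intro h
  refine hpd fun i hi => ?_
  rw [← h i hi]
  exact (splice_edge_lt _ (hi.trans hm)).symm

/-- A member `p = α d^∞` with `α` at least as long as `d` gives an injective self-map `x ↦ αx` of
the set. It misses `p`, whose only possible preimage `d^∞` is divisible by `d`. -/
theorem LSet_inf_infinite {d : G.ClosedPath} (hne : (LSet d d.inf).Nonempty) :
    (LSet d d.inf).Infinite := by
  obtain ⟨p, hp⟩ := hne
  obtain ⟨m, hnm, hm⟩ := d.exists_drop_eq_inf hp.1 d.edges.length
  have hms : G.s (p.edge m) = d.src := by
    rw [← d.src_inf, ← hm]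
    rfl
  have hstep : ∀ x : LSet d d.inf, splice p m x (hms.trans x.2.2.1.symm) ∈ LSet d d.inf := by
    intro x
    refine ⟨Setoid.trans (splice_equiv _) x.2.1,
      (src_splice (d.length_pos.trans_le hnm) _).trans hp.2.1, ?_⟩
    have hpd := hp.2.2
    rw [divisibleBy_iff] at hpd ⊢
    intro h
    refine hpd fun i hi => ?_
    rw [← h i hi]
    exact (splice_edge_lt _ (by omega)).symm
  let f : LSet d d.inf → LSet d d.inf := fun x => ⟨_, hstep x⟩
  have hf : Function.Injective f := fun x y hxy =>
    Subtype.ext (splice_injective (hms.trans x.2.2.1.symm) (hms.trans y.2.2.1.symm)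
      (congrArg Subtype.val hxy))
  intro hfin
  have := hfin.to_subtype
  obtain ⟨y, hy⟩ := (Finite.injective_iff_surjective.mp hf) ⟨p, hp⟩
  refine y.2.2.2 ?_
  have hy' : splice p m y (hms.trans y.2.2.1.symm) = p := congrArg Subtype.val hy
  have : y.1 = d.inf := by
    exact (drop_splice (hms.trans y.2.2.1.symm)).symm.trans (by rw [hy', hm])
  rw [this, divisibleBy_iff]
  exact fun _ _ => rfl

/-! ### Path products and the `ℤ`-grading of the Leavitt path algebra -/

section Leavitt

variable (K : Type u) [Field K] [Fintype G.V] [Fintype G.E]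

namespace LPA

/-- A generator as an element of the Leavitt path algebra. -/
noncomputable def gen (x : LGen G) : LPA K G :=
  RingQuot.mkAlgHom K (LRel K G) (FreeAlgebra.ι K x)

variable {K} in
theorem induction {P : LPA K G → Prop} (x : LPA K G) (algebraMap : ∀ k, P (algebraMap K _ k))
    (gen : ∀ x, P (gen K x)) (add : ∀ x y, P x → P y → P (x + y))
    (mul : ∀ x y, P x → P y → P (x * y)) : P x := by
  obtain ⟨a, rfl⟩ := RingQuot.mkAlgHom_surjective K (LRel K G) x
  induction a using FreeAlgebra.induction with
  | grade0 k => rw [AlgHom.commutes]; exact algebraMap k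
  | grade1 x => exact gen x
  | mul a b ha hb => rw [map_mul]; exact mul _ _ ha hb
  | add a b ha hb => rw [map_add]; exact add _ _ ha hb

theorem rel {a b : FreeAlgebra K (LGen G)} (h : LRel K G a b) :
    RingQuot.mkAlgHom K (LRel K G) a = RingQuot.mkAlgHom K (LRel K G) b :=
  RingQuot.mkAlgHom_rel K h

theorem vert_mul_vert (w : G.V) : gen K (.vert w) * gen K (.vert w) = gen K (.vert w) := by
  simpa only [gen, map_mul] using rel K (.vert_self w)

theorem vert_mul_vert_ne {w x : G.V} (h : w ≠ x) : gen K (.vert w) * gen K (.vert x) = 0 := by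
  simpa only [gen, map_mul, map_zero] using rel K (.vert_ne w x h)

theorem src_mul_edge (e : G.E) : gen K (.vert (G.s e)) * gen K (.edge e) = gen K (.edge e) := by
  simpa only [gen, map_mul] using rel K (.src_edge e)

theorem edge_mul_rng (e : G.E) : gen K (.edge e) * gen K (.vert (G.r e)) = gen K (.edge e) := by
  simpa only [gen, map_mul] using rel K (.edge_rng e)

theorem ghost_mul_edge (e : G.E) : gen K (.ghost e) * gen K (.edge e) = gen K (.vert (G.r e)) := by
  simpa only [gen, map_mul] using rel K (.ck1_self e)

theorem ghost_mul_edge_ne {e f : G.E} (h : e ≠ f) : gen K (.ghost e) * gen K (.edge f) = 0 := by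
  simpa only [gen, map_mul, map_zero] using rel K (.ck1_ne e f h)

/-- The product of the first `m` edges of an infinite path. -/
noncomputable def prefixProd (p : G.InfPath) : ℕ → LPA K G
  -- The empty product is the unit, not the source vertex, so statements involving the source or
  -- range need positive length.
  | 0 => 1
  | m + 1 => prefixProd p m * gen K (.edge (p.edge m))

theorem prefixProd_add (p : G.InfPath) (a b : ℕ) :
    prefixProd K p (a + b) = prefixProd K p a * prefixProd K (p.drop a) b := by
  induction b with
  | zero => simp [prefixProd]
  | succ b ih => rw [← add_assoc, prefixProd, ih, mul_assoc]; rfl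

theorem prefixProd_one (p : G.InfPath) : prefixProd K p 1 = gen K (.edge (p.edge 0)) := by
  simp [prefixProd]

theorem prefixProd_succ' (p : G.InfPath) (m : ℕ) :
    prefixProd K p (m + 1) = gen K (.edge (p.edge 0)) * prefixProd K p.tail m := by
  rw [add_comm, prefixProd_add, tail_eq_drop, prefixProd_one]

theorem prefixProd_mul (d : G.ClosedPath) (k : ℕ) :
    prefixProd K d.inf (d.edges.length * k) = prefixProd K d.inf d.edges.length ^ k := by
  induction k with
  | zero => rw [mul_zero, pow_zero, prefixProd]
  | succ k ih => rw [Nat.mul_succ, prefixProd_add, ih, d.drop_inf, pow_succ]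

theorem src_mul_prefixProd (p : G.InfPath) {m : ℕ} (hm : 0 < m) :
    gen K (.vert p.src) * prefixProd K p m = prefixProd K p m := by
  obtain ⟨m, rfl⟩ := Nat.exists_eq_succ_of_ne_zero hm.ne'
  rw [Nat.succ_eq_add_one, prefixProd_succ', ← mul_assoc, InfPath.src, src_mul_edge]

/-- The degree of a generator. -/
def genDegree : LGen G → ℤ
  | .vert _ => 0
  | .edge _ => 1
  | .ghost _ => -1

/-- The free algebra homomorphism which multiplies each generator by a power of the variable. -/
noncomputable def freeGrading :
    FreeAlgebra K (LGen G) →ₐ[K] AddMonoidAlgebra (LPA K G) ℤ :=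
  FreeAlgebra.lift K fun x => AddMonoidAlgebra.single (genDegree x) (gen K x)

/-- Each defining relation is homogeneous: both sides become the same element of `L` placed in one
common degree. -/
theorem freeGrading_rel {a b : FreeAlgebra K (LGen G)} (h : LRel K G a b) :
    freeGrading K a = freeGrading K b := by
  have hr := rel K h
  have key : ∀ (n : ℤ) (a b : FreeAlgebra K (LGen G)),
      freeGrading K a = .single n (RingQuot.mkAlgHom K (LRel K G) a) →
      freeGrading K b = .single n (RingQuot.mkAlgHom K (LRel K G) b) →
      RingQuot.mkAlgHom K (LRel K G) a = RingQuot.mkAlgHom K (LRel K G) b →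
      freeGrading K a = freeGrading K b := by
    intro n a b ha hb hab
    rw [ha, hb, hab]
  have hzero : ∀ n : ℤ, freeGrading K (0 : FreeAlgebra K (LGen G)) =
      .single n (RingQuot.mkAlgHom K (LRel K G) 0) := by
    intro n
    simp
  have hgen : ∀ x : LGen G, freeGrading K (FreeAlgebra.ι K x) =
      .single (genDegree x) (RingQuot.mkAlgHom K (LRel K G) (FreeAlgebra.ι K x)) := by
    intro x
    exact FreeAlgebra.lift_ι_apply _ _
  have hmul : ∀ x y : LGen G, freeGrading K (FreeAlgebra.ι K x * FreeAlgebra.ι K y) =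
      .single (genDegree x + genDegree y)
        (RingQuot.mkAlgHom K (LRel K G) (FreeAlgebra.ι K x * FreeAlgebra.ι K y)) := by
    intro x y
    rw [map_mul, map_mul, hgen, hgen, AddMonoidAlgebra.single_mul_single]
  have hsum : ∀ (ι : Type v) (s : Finset ι) (f : ι → FreeAlgebra K (LGen G)) (n : ℤ),
      (∀ i ∈ s, freeGrading K (f i) = .single n (RingQuot.mkAlgHom K (LRel K G) (f i))) →
      freeGrading K (∑ i ∈ s, f i) =
        .single n (RingQuot.mkAlgHom K (LRel K G) (∑ i ∈ s, f i)) := by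
    intro ι s f n h
    rw [map_sum, map_sum, Finset.sum_congr rfl h]
    exact (map_sum (AddMonoidAlgebra.singleAddHom n) _ _).symm
  cases h with
  | vert_self w => exact key 0 _ _ (hmul _ _) (hgen _) hr
  | vert_ne w x h => exact key 0 _ _ (hmul _ _) (hzero _) hr
  | src_edge e => exact key 1 _ _ (hmul _ _) (hgen _) hr
  | edge_rng e => exact key 1 _ _ (hmul _ _) (hgen _) hr
  | rng_ghost e => exact key (-1) _ _ (hmul _ _) (hgen _) hr
  | ghost_src e => exact key (-1) _ _ (hmul _ _) (hgen _) hr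
  | ck1_self e => exact key 0 _ _ (hmul _ _) (hgen _) hr
  | ck1_ne e f h => exact key 0 _ _ (hmul _ _) (hzero _) hr
  | ck2 w h => exact key 0 _ _ (hgen _) (hsum _ _ _ 0 fun e _ => hmul _ _) hr
  | one =>
    refine key 0 _ _ ?_ (hsum _ _ _ 0 fun w _ => hgen _) hr
    rw [map_one, map_one]
    rfl

/-- The `ℤ`-grading of the Leavitt path algebra, as a coaction of Laurent polynomials. -/
noncomputable def grading : LPA K G →ₐ[K] AddMonoidAlgebra (LPA K G) ℤ :=
  RingQuot.liftAlgHom K ⟨freeGrading K, fun _ _ h => freeGrading_rel K h⟩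

theorem grading_gen (x : LGen G) :
    grading K (gen K x) = AddMonoidAlgebra.single (genDegree x) (gen K x) := by
  rw [grading, gen, RingQuot.liftAlgHom_mkAlgHom_apply]
  exact FreeAlgebra.lift_ι_apply _ _

/-- Setting the Laurent variable to `1` is a left inverse. -/
theorem grading_injective : Function.Injective (grading K (G := G)) := by
  let ev : AddMonoidAlgebra (LPA K G) ℤ →+* LPA K G :=
    AddMonoidAlgebra.liftNCRingHom (RingHom.id _) 1 fun _ _ => Commute.one_right _
  have hev : ∀ (n : ℤ) (a : LPA K G), ev (AddMonoidAlgebra.single n a) = a := by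
    intro n a
    exact (AddMonoidAlgebra.liftNCRingHom_single _ _ _ n a).trans (mul_one a)
  refine Function.LeftInverse.injective (g := ev) fun x => ?_
  induction x using LPA.induction with
  | algebraMap k => rw [AlgHom.commutes]; exact hev 0 _
  | gen x => rw [grading_gen, hev]
  | add x y hx hy => rw [map_add, map_add, hx, hy]
  | mul x y hx hy => rw [map_mul, map_mul, hx, hy]

theorem grading_prefixProd (p : G.InfPath) (m : ℕ) :
    grading K (prefixProd K p m) = AddMonoidAlgebra.single (m : ℤ) (prefixProd K p m) := by
  induction m with
  | zero => rw [prefixProd, map_one]; rfl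
  | succ m ih =>
    rw [prefixProd, map_mul, ih, grading_gen, AddMonoidAlgebra.single_mul_single]
    push_cast
    rfl

variable {K} in
/-- Right multiplication by `α - 1` is injective for a finite path `α` of positive length. -/
theorem eq_zero_of_mul_prefixProd_eq {p : G.InfPath} {m : ℕ} (hm : 0 < m) {x : LPA K G}
    (h : x * prefixProd K p m = x) : x = 0 := by
  apply grading_injective K
  rw [map_zero]
  have hx := congrArg (grading K) h
  rw [map_mul, grading_prefixProd] at hx
  set y := grading K x
  by_contra hy
  have hne : y.coeff.support.Nonempty := by
    rw [Finsupp.support_nonempty_iff]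
    simpa using hy
  obtain ⟨n, hn, hmin⟩ := y.coeff.support.exists_min_image id hne
  -- Compare components in the lowest degree `n` of `x`: on the left it comes from degree `n - m`,
  -- where `x` has nothing.
  have hc := congrArg (fun z => z.coeff n) hx
  simp only [AddMonoidAlgebra.coeff_mul_single_apply] at hc
  have hz : y.coeff (n + -(m : ℤ)) = 0 := by
    by_contra h0
    have := hmin _ (Finsupp.mem_support_iff.mpr h0)
    simp only [id] at this
    omega
  rw [hz, zero_mul] at hc
  exact Finsupp.mem_support_iff.mp hn hc.symm

end LPA

open LPA

/-! ### Action of path products on `V_{[p]}` -/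

namespace ChenSpace

variable {K} {ξ : G.TailClass}

theorem smul_def (x : LPA K G) (y : ChenSpace K ξ) : x • y = rep K ξ x y := rfl

theorem rep_gen (x : LGen G) : rep K ξ (LPA.gen K x) = gen K ξ x := by
  rw [rep, LPA.gen, RingQuot.liftAlgHom_mkAlgHom_apply, FreeAlgebra.lift_ι_apply]

theorem gen_smul_path (x : LGen G) (q : ξ.Mem) : LPA.gen K x • path K q = genPath K ξ x q := by
  rw [smul_def, rep_gen, gen_path]

theorem algebraMap_smul (k : K) (y : ChenSpace K ξ) : algebraMap K (LPA K G) k • y = k • y := by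
  rw [smul_def, AlgHom.commutes]
  rfl

protected theorem smul_comm (x : LPA K G) (k : K) (y : ChenSpace K ξ) : x • k • y = k • x • y :=
  (rep K ξ x).map_smul k y

/-- The path `α q`, where `α` consists of the first `m` edges of `x`. -/
def spliceMem (x : G.InfPath) (m : ℕ) (q : ξ.Mem) (h : G.s (x.edge m) = q.1.src) : ξ.Mem :=
  ⟨splice x m q.1 h, (Quotient.sound (splice_equiv h)).trans q.2⟩

theorem prefixProd_smul (x : G.InfPath) (m : ℕ) (q : ξ.Mem) (h : G.s (x.edge m) = q.1.src) :
    prefixProd K x m • path K q = path K (spliceMem x m q h) := by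
  induction m generalizing x with
  | zero =>
    rw [prefixProd, one_smul]
    congr 1
  | succ m ih =>
    have ht : G.s (x.tail.edge m) = q.1.src := h
    have h1 : G.r (x.edge 0) = (splice x.tail m q.1 ht).src := by
      rcases Nat.eq_zero_or_pos m with rfl | hm
      · rw [← x.compat]
        exact h.trans (congrArg G.s (splice_edge_add ht 0)).symm
      · rw [src_splice hm, src_tail]
    rw [prefixProd_succ', mul_smul, ih x.tail ht, gen_smul_path]
    refine (dif_pos h1).trans (congrArg (path K) (Subtype.ext ?_))
    ext k
    cases k with
    | zero => rfl
    | succ k => simp [cons, splice, tail, spliceMem]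

theorem prefixProd_smul_ne (x : G.InfPath) {m : ℕ} (hm : 0 < m) (q : ξ.Mem)
    (h : G.s (x.edge m) ≠ q.1.src) : prefixProd K x m • path K q = 0 := by
  obtain ⟨m, rfl⟩ := Nat.exists_eq_succ_of_ne_zero hm.ne'
  have h1 : ¬ G.r (x.edge m) = q.1.src := by rwa [← x.compat]
  rw [prefixProd, mul_smul, gen_smul_path, genPath, dif_neg h1, smul_zero]

omit [Fintype G.V] [Fintype G.E] in
theorem induction {P : ChenSpace K ξ → Prop} (y : ChenSpace K ξ) (zero : P 0)
    (add : ∀ x y, P x → P y → P (x + y)) (smul_path : ∀ (k : K) q, P (k • path K q)) : P y := by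
  refine Finsupp.induction_linear y zero (fun f g => add f g) fun q k => ?_
  have := smul_path k q
  rwa [show k • path K q = (Finsupp.single q k : ξ.Mem →₀ K) from by
    exact (Finsupp.smul_single k q 1).trans (by simp)] at this

end ChenSpace

end Leavitt

/-! ### The resolution of `V_{[d^∞]}` -/

section Resolution

variable (K : Type u) [Field K] [Fintype G.V] [Fintype G.E]

open LPA ChenSpace

namespace ClosedPath

/-- A closed path as an element of the Leavitt path algebra. -/
noncomputable def prod (d : G.ClosedPath) : LPA K G := prefixProd K d.inf d.edges.length

/-- The left ideal generated by `d - 1`. -/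
noncomputable def ideal (d : G.ClosedPath) : Ideal (LPA K G) := Ideal.span {d.prod K - 1}

/-- The path `d^∞` as an element of its tail equivalence class. -/
def infMem (d : G.ClosedPath) : TailClass.Mem (⟦d.inf⟧ : G.TailClass) := ⟨d.inf, rfl⟩

variable {K} in
theorem mk_mul_prod_pow (d : G.ClosedPath) (x : LPA K G) (k : ℕ) :
    (Submodule.Quotient.mk (x * d.prod K ^ k) : LPA K G ⧸ d.ideal K) =
      Submodule.Quotient.mk x := by
  induction k with
  | zero => rw [pow_zero, mul_one]
  | succ k ih =>
    rw [← ih, Submodule.Quotient.eq, ideal, Ideal.mem_span_singleton']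
    exact ⟨x * d.prod K ^ k, by rw [mul_sub, mul_one, mul_assoc, pow_succ]⟩

/-- Simplicity enters here: two cuts leaving `d^∞` differ by a multiple of the length of `d`, so the
prefixes differ by a right factor `d^k`, which is invisible modulo `L(d - 1)`. -/
theorem mk_prefixProd_eq {d : G.ClosedPath} (hd : d.IsSimple) {q : G.InfPath} {m m' : ℕ}
    (h : q.drop m = d.inf) (h' : q.drop m' = d.inf) :
    (Submodule.Quotient.mk (prefixProd K q m) : LPA K G ⧸ d.ideal K) =
      Submodule.Quotient.mk (prefixProd K q m') := by
  wlog hle : m ≤ m' generalizing m m'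
  · exact (this h' h (le_of_not_ge hle)).symm
  obtain ⟨j, rfl⟩ := Nat.exists_eq_add_of_le hle
  obtain ⟨k, rfl⟩ := hd.length_dvd (j := j) (by rw [← h, drop_drop, h', h])
  rw [prefixProd_add, h, prefixProd_mul]
  exact (d.mk_mul_prod_pow _ k).symm

omit [Fintype G.V] [Fintype G.E] in
theorem exists_drop_eq_inf_of_mem (d : G.ClosedPath) (q : TailClass.Mem (⟦d.inf⟧ : G.TailClass))
    (N : ℕ) : ∃ m, N ≤ m ∧ q.1.drop m = d.inf :=
  d.exists_drop_eq_inf (Quotient.exact q.2) N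

/-- The linear map from `V_{[d^∞]}` to the quotient by the left ideal generated by `d - 1` that
sends a path `α d^∞` to the class of `α`. -/
noncomputable def toQuotient (d : G.ClosedPath) :
    ChenSpace K (⟦d.inf⟧ : G.TailClass) →ₗ[K] LPA K G ⧸ d.ideal K :=
  Finsupp.linearCombination K fun q : TailClass.Mem (⟦d.inf⟧ : G.TailClass) =>
    Submodule.Quotient.mk (prefixProd K q.1 (d.exists_drop_eq_inf_of_mem q 0).choose)

theorem toQuotient_path {d : G.ClosedPath} (hd : d.IsSimple)
    (q : TailClass.Mem (⟦d.inf⟧ : G.TailClass)) {m : ℕ} (h : q.1.drop m = d.inf) :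
    d.toQuotient K (path K q) = Submodule.Quotient.mk (prefixProd K q.1 m) :=
  (Finsupp.linearCombination_single K (1 : K) q).trans <| (one_smul K _).trans <|
    mk_prefixProd_eq K hd (d.exists_drop_eq_inf_of_mem q 0).choose_spec.2 h

theorem toQuotient_gen_smul_path {d : G.ClosedPath} (hd : d.IsSimple) (x : LGen G)
    (q : TailClass.Mem (⟦d.inf⟧ : G.TailClass)) :
    d.toQuotient K (LPA.gen K x • path K q) = LPA.gen K x • d.toQuotient K (path K q) := by
  -- A cut at `m ≥ 2` leaves a prefix of positive length even after a ghost edge removes the first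
  -- edge.
  obtain ⟨m, hm, hq⟩ := d.exists_drop_eq_inf_of_mem q 2
  rw [toQuotient_path K hd q hq, ← Submodule.Quotient.mk_smul, smul_eq_mul, gen_smul_path]
  have htail : q.1.tail.drop (m - 1) = d.inf := by
    rw [tail_eq_drop, drop_drop, show 1 + (m - 1) = m by omega, hq]
  cases x with
  | vert w =>
    by_cases h : w = q.1.src
    · rw [genPath, if_pos h, toQuotient_path K hd q hq, h, src_mul_prefixProd K _ (by omega)]
    · rw [genPath, if_neg h, map_zero, ← src_mul_prefixProd K _ (by omega), ← mul_assoc,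
        vert_mul_vert_ne K h, zero_mul, Submodule.Quotient.mk_zero]
  | edge e =>
    by_cases h : G.r e = q.1.src
    · rw [genPath, dif_pos h, toQuotient_path K hd _ (m := m + 1), prefixProd_succ']
      · rfl
      · change (cons e q.1 h).drop (m + 1) = _
        rw [add_comm, ← drop_drop, ← tail_eq_drop, tail_cons, hq]
    · rw [genPath, dif_neg h, map_zero, ← edge_mul_rng, mul_assoc,
        ← src_mul_prefixProd K _ (by omega), ← mul_assoc (LPA.gen K (.vert (G.r e))),
        vert_mul_vert_ne K h, zero_mul, mul_zero, Submodule.Quotient.mk_zero]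
  | ghost e =>
    have hp : prefixProd K q.1 m =
        LPA.gen K (.edge (q.1.edge 0)) * prefixProd K q.1.tail (m - 1) := by
      rw [← prefixProd_succ']
      congr 1
      omega
    by_cases h : e = q.1.edge 0
    · rw [genPath, if_pos h, toQuotient_path K hd _ (m := m - 1) htail, hp, h, ← mul_assoc,
        ghost_mul_edge, ← src_tail, src_mul_prefixProd K _ (by omega)]
    · rw [genPath, if_neg h, map_zero, hp, ← mul_assoc, ghost_mul_edge_ne K h, zero_mul,
        Submodule.Quotient.mk_zero]

theorem toQuotient_smul {d : G.ClosedPath} (hd : d.IsSimple) (x : LPA K G)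
    (y : ChenSpace K (⟦d.inf⟧ : G.TailClass)) :
    d.toQuotient K (x • y) = x • d.toQuotient K y := by
  induction x using LPA.induction generalizing y with
  | algebraMap k =>
    rw [ChenSpace.algebraMap_smul, _root_.algebraMap_smul, (d.toQuotient K).map_smul]
  | gen x =>
    induction y using ChenSpace.induction with
    | zero => simp only [smul_zero, map_zero]
    | add a b ha hb => simp only [smul_add, map_add, ha, hb]
    | smul_path k q =>
      rw [ChenSpace.smul_comm, (d.toQuotient K).map_smul, (d.toQuotient K).map_smul,
        toQuotient_gen_smul_path K hd, ← _root_.algebraMap_smul (LPA K G) k, ← mul_smul,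
        Algebra.commutes, mul_smul, _root_.algebraMap_smul]
  | add a b ha hb => rw [add_smul, add_smul, map_add, ha, hb]
  | mul a b ha hb => rw [mul_smul, mul_smul, ha, hb]

/-- `toQuotient` is `L`-linear and sends `d^∞` to the class of `1`, so an annihilator of `d^∞` has
class zero. -/
theorem exists_of_smul_inf_eq_zero {d : G.ClosedPath} (hd : d.IsSimple) {x : LPA K G}
    (hx : x • path K d.infMem = 0) : ∃ y, y * (d.prod K - 1) = x := by
  have h := toQuotient_smul K hd x (path K d.infMem)
  rw [hx, map_zero, toQuotient_path K hd d.infMem (m := 0) (drop_zero _), prefixProd,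
    ← Submodule.Quotient.mk_smul, smul_eq_mul, mul_one, eq_comm,
    Submodule.Quotient.mk_eq_zero] at h
  exact Ideal.mem_span_singleton'.mp h

theorem prod_smul_inf (d : G.ClosedPath) : d.prod K • path K d.infMem = path K d.infMem := by
  have h : G.s (d.inf.edge d.edges.length) = d.inf.src :=
    d.inf_edge_length.trans d.src_inf.symm
  rw [prod, prefixProd_smul _ _ d.infMem h]
  congr 1
  refine Subtype.ext (splice_drop _ _ _ h ?_)
  simpa using d.drop_inf 1

theorem exists_smul_inf_eq (d : G.ClosedPath) (y : ChenSpace K (⟦d.inf⟧ : G.TailClass)) :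
    ∃ x : LPA K G, x • path K d.infMem = y := by
  induction y using ChenSpace.induction with
  | zero => exact ⟨0, zero_smul _ _⟩
  | add a b ha hb =>
    obtain ⟨x, rfl⟩ := ha
    obtain ⟨y, rfl⟩ := hb
    exact ⟨x + y, add_smul _ _ _⟩
  | smul_path k q =>
    obtain ⟨m, -, hm⟩ := d.exists_drop_eq_inf_of_mem q 0
    have h : G.s (q.1.edge m) = d.inf.src := congrArg InfPath.src hm
    refine ⟨algebraMap K _ k * prefixProd K q.1 m, ?_⟩
    rw [mul_smul, ChenSpace.algebraMap_smul, prefixProd_smul _ _ d.infMem h]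
    congr 2
    exact Subtype.ext (splice_drop _ _ _ h hm)

/-- The projective resolution of `V_{[d^∞]}` by right multiplication with `d - 1`. -/
noncomputable def resolution (d : G.ClosedPath) :
    ShortComplex (ModuleCat.{max u v} (LPA K G)) :=
  ShortComplex.moduleCatMk (LinearMap.toSpanSingleton (LPA K G) (LPA K G) (d.prod K - 1))
    (LinearMap.toSpanSingleton (LPA K G) (ChenSpace K (⟦d.inf⟧ : G.TailClass))
      (path K d.infMem)) (by
    ext
    simp only [LinearMap.comp_apply, LinearMap.toSpanSingleton_apply, one_smul, sub_smul,
      prod_smul_inf, sub_self, LinearMap.zero_apply])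

theorem resolution_shortExact {d : G.ClosedPath} (hd : d.IsSimple) :
    (d.resolution K).ShortExact where
  exact := by
    rw [ShortComplex.moduleCat_exact_iff]
    exact fun x hx => exists_of_smul_inf_eq_zero K hd hx
  mono_f := by
    rw [ModuleCat.mono_iff_injective]
    refine (injective_iff_map_eq_zero (d.resolution K).f.hom).mpr fun (x : LPA K G) hx => ?_
    have hx' : x * (d.prod K - 1) = 0 := hx
    rw [mul_sub, mul_one, sub_eq_zero] at hx'
    exact eq_zero_of_mul_prefixProd_eq d.length_pos hx'
  epi_g := by
    rw [ModuleCat.epi_iff_surjective]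
    exact d.exists_smul_inf_eq K

end ClosedPath

end Resolution

/-! ### Computing `Ext¹` from the long exact sequence -/

section Ext

universe w

open Abelian

/-- Projectivity of the middle term makes every class the connecting image of a map from `S.X₁`;
maps that extend along `S.f` have image zero. -/
theorem subsingleton_ext_of_shortExact {C : Type*} [Category* C] [Abelian C] [HasExt.{w} C]
    {S : ShortComplex C} (hS : S.ShortExact) [Projective S.X₂] {N : C}
    (h : ∀ φ : S.X₁ ⟶ N, ∃ ψ, S.f ≫ ψ = φ) : Subsingleton (Ext S.X₃ N 1) := by
  refine subsingleton_of_forall_eq 0 fun x => ?_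
  obtain ⟨y, rfl⟩ := Ext.contravariant_sequence_exact₃ hS N x
    (Ext.eq_zero_of_projective (n := 0) _) (add_zero 1)
  obtain ⟨φ, rfl⟩ := Ext.homEquiv₀.symm.surjective y
  obtain ⟨ψ, rfl⟩ := h φ
  rw [Ext.homEquiv₀_symm_apply, ← Ext.mk₀_comp_mk₀]
  exact hS.extClass_comp_assoc _

/-- The kernel of the connecting map consists of the maps factoring through `S.f`, so independence
modulo these survives in Ext. -/
theorem linearIndependent_extClass_comp {K : Type*} [CommRing K] {C : Type*} [Category* C]
    [Abelian C] [Linear K C] [HasExt.{w} C] {S : ShortComplex C} (hS : S.ShortExact) {N : C}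
    {ι : Type*} (φ : ι → (S.X₁ ⟶ N))
    (h : ∀ (c : ι →₀ K) (ψ : S.X₂ ⟶ N), S.f ≫ ψ = Finsupp.linearCombination K φ c → c = 0) :
    LinearIndependent K fun i => hS.extClass.comp (Ext.mk₀ (φ i)) (add_zero 1) := by
  let δ : (S.X₁ ⟶ N) →ₗ[K] Ext S.X₃ N 1 :=
    (Ext.precompOfLinear hS.extClass K N (add_zero 1)).comp
      (Ext.linearEquiv₀ (R := K)).symm.toLinearMap
  change LinearIndependent K (δ ∘ φ)
  rw [linearIndependent_iff]
  intro c hc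
  have hc' : δ (Finsupp.linearCombination K φ c) = 0 := by
    rw [← hc, Finsupp.apply_linearCombination]
  obtain ⟨y, hy⟩ := Ext.contravariant_sequence_exact₁ hS N _ (add_zero 1) hc'
  obtain ⟨ψ, rfl⟩ := Ext.homEquiv₀.symm.surjective y
  rw [Ext.homEquiv₀_symm_apply, Ext.mk₀_comp_mk₀] at hy
  exact h c ψ ((Ext.mk₀_bijective _ _).1 hy)

variable {K : Type u} [Field K] {A : Type w} [Ring A] [Algebra K A] {M : Type w} [AddCommGroup M]
  [Module A M] {a : A} {g : A →ₗ[A] M} {hg : g.comp (LinearMap.toSpanSingleton A A a) = 0}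

/-- If `0 → A → A → M → 0` is exact, where the first map is right multiplication by `a`, then
`Ext¹(M, N)` vanishes when `a` acts surjectively on `N`. -/
theorem subsingleton_ext_of_smul_surjective
    (hS : (ShortComplex.moduleCatMk (LinearMap.toSpanSingleton A A a) g hg).ShortExact)
    (N : Type w) [AddCommGroup N] [Module A N] (h : ∀ t : N, ∃ s : N, a • s = t) :
    Subsingleton (Ext (ModuleCat.of A M) (ModuleCat.of A N) 1) := by
  have : Projective (ShortComplex.moduleCatMk (LinearMap.toSpanSingleton A A a) g hg).X₂ :=
    inferInstanceAs (Projective (ModuleCat.of A A))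
  refine subsingleton_ext_of_shortExact hS fun φ => ?_
  obtain ⟨s, hs⟩ := h (φ.hom (1 : A))
  refine ⟨ModuleCat.ofHom (LinearMap.toSpanSingleton A N s), ?_⟩
  refine ModuleCat.hom_ext (LinearMap.ext_ring ?_)
  refine Eq.trans ?_ hs
  change ((1 : A) • a) • s = _
  rw [one_smul]

/-- If `0 → A → A → M → 0` is exact, where the first map is right multiplication by `a`, and
`Ext¹(M, N)` is finite-dimensional, then families in `N` that are linearly independent modulo `a N`
are finite. -/
theorem finite_of_finite_ext
    (hS : (ShortComplex.moduleCatMk (LinearMap.toSpanSingleton A A a) g hg).ShortExact)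
    (N : Type w) [AddCommGroup N] [Module A N]
    [Module.Finite K (Ext (ModuleCat.of A M) (ModuleCat.of A N) 1)] {ι : Type*} (t : ι → N)
    (ht : ∀ (c : ι →₀ K) (s : N), (c.sum fun i k => algebraMap K A k • t i) = a • s → c = 0) :
    Finite ι := by
  have hli := linearIndependent_extClass_comp (K := K) hS (N := ModuleCat.of A N)
    (fun i => ModuleCat.ofHom (LinearMap.toSpanSingleton A N (t i))) (by
      intro c ψ hψ
      -- Evaluation at `1` turns maps factoring through right multiplication by `a` into elements of
      -- `a N`.
      let ev : (ModuleCat.of A A ⟶ ModuleCat.of A N) →+ N :=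
        { toFun := fun f => f.hom (1 : A)
          map_zero' := rfl
          map_add' := fun _ _ => rfl }
      refine ht c (ψ.hom (1 : A)) ?_
      have h1 := congrArg ev hψ
      have h2 := h1.trans <| (congrArg ev (Finsupp.linearCombination_apply K c)).trans
        (map_finsuppSum ev c _)
      refine Eq.trans ?_ (h2.symm.trans ?_)
      · refine Finsupp.sum_congr fun i _ => ?_
        change _ = algebraMap K A (c i) • ((1 : A) • t i)
        rw [one_smul]
      · let ψ' : A →ₗ[A] N := ψ.hom
        change ψ' ((1 : A) • a) = a • ψ' 1
        rw [← ψ'.map_smul, smul_eq_mul, smul_eq_mul, one_mul, mul_one])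
  have : Module.Finite K (Ext (ShortComplex.moduleCatMk
    (LinearMap.toSpanSingleton A A a) g hg).X₃ (ModuleCat.of A N) 1) := ‹_›
  exact hli.finite_of_isNoetherian

end Ext

/-! ### Powers of `d` in front of a path -/

/-- The paths `d^k p₀`. -/
inductive PowMul (d : G.ClosedPath) (p₀ : G.InfPath) : G.InfPath → Prop
  | base : PowMul d p₀ p₀
  | step (p : G.InfPath) (h : G.s (d.inf.edge d.edges.length) = p.src) :
      PowMul d p₀ p → PowMul d p₀ (splice d.inf d.edges.length p h)

theorem divisibleBy_splice (d : G.ClosedPath) (p : G.InfPath)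
    (h : G.s (d.inf.edge d.edges.length) = p.src) :
    (splice d.inf d.edges.length p h).DivisibleBy d :=
  (divisibleBy_iff _ _).mpr fun _ hi => splice_edge_lt h hi

theorem PowMul.eq_of_not_divisibleBy {d : G.ClosedPath} {p₀ p : G.InfPath} (h : PowMul d p₀ p)
    (hp : ¬ p.DivisibleBy d) : p = p₀ := by
  cases h with
  | base => rfl
  | step p h => exact absurd (divisibleBy_splice d p h) hp

theorem PowMul.src_eq {d : G.ClosedPath} {p₀ p : G.InfPath} (h : PowMul d p₀ p)
    (hp : p₀.src = d.src) : p.src = d.src := by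
  cases h with
  | base => exact hp
  | step p h => rw [src_splice d.length_pos, d.src_inf]

/-- Since `p₀` is not divisible by `d`, a path `dp` can only arise from a step, and a leading `d`
cancels. -/
theorem powMul_splice_iff {d : G.ClosedPath} {p₀ : G.InfPath} (h₀ : ¬ p₀.DivisibleBy d)
    (p : G.InfPath) (h : G.s (d.inf.edge d.edges.length) = p.src) :
    PowMul d p₀ (splice d.inf d.edges.length p h) ↔ PowMul d p₀ p := by
  refine ⟨fun hp => ?_, PowMul.step p h⟩
  generalize hx : splice d.inf d.edges.length p h = x at hp
  cases hp with
  | base => exact absurd (hx ▸ divisibleBy_splice d p h) h₀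
  | step p' h' hp' => exact splice_injective h h' hx ▸ hp'

/-- An irrational path that starts at the source of `d` is of the form `d^k p` with `p` not
divisible by `d`. -/
theorem LSet_nonempty {d : G.ClosedPath} {q p : G.InfPath} (hq : ¬ q.IsRational) (hpq : p ≈ q)
    (hp : p.src = d.src) : (LSet d q).Nonempty := by
  -- Otherwise `d` could be stripped off forever, forcing `p = d^∞`, which is rational.
  by_contra hne
  have hdiv : ∀ x : G.InfPath, x ≈ q → x.src = d.src → x.DivisibleBy d := fun x hxq hx =>
    not_not.mp fun h => hne ⟨x, hxq, hx, h⟩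
  have hequiv : ∀ m, p.drop m ≈ q := fun m => Setoid.trans (drop_equiv p m) hpq
  have hsrc : ∀ k, (p.drop (d.edges.length * k)).src = d.src := by
    intro k
    induction k with
    | zero => rw [mul_zero, drop_zero, hp]
    | succ k ih =>
      have h := (divisibleBy_iff _ _).mp (hdiv _ (hequiv _) ih) (d.edges.length - 1)
        (Nat.sub_lt d.length_pos one_pos)
      have hlast : d.edges.length - 1 + 1 = d.edges.length := Nat.sub_add_cancel d.length_pos
      rw [Nat.mul_succ, ← drop_drop]
      change G.s ((p.drop (d.edges.length * k)).edge d.edges.length) = _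
      generalize p.drop (d.edges.length * k) = x at h
      rw [← hlast, InfPath.compat, h, ← d.inf.compat, hlast, d.inf_edge_length]
  refine hq (isRational_congr hpq ⟨d, ?_⟩)
  have : p = d.inf := by
    ext i
    have h := (divisibleBy_iff _ _).mp (hdiv _ (hequiv _) (hsrc (i / d.edges.length)))
      (i % d.edges.length) (Nat.mod_lt _ d.length_pos)
    rw [d.inf_periodic.map_mod_nat] at h
    rw [← h]
    exact congrArg p.edge (Nat.div_add_mod _ _).symm
  rw [this]

/-! ### Vanishing and infinite-dimensionality of Ext -/

section Leavitt

variable {K : Type u} [Field K] [Fintype G.V] [Fintype G.E]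

open LPA ChenSpace

open scoped Classical in
variable (K) in
/-- The functional on `V_{[p]}` that sends the paths `d^k p₀` to `1` and the others to `0`. -/
noncomputable def powMulFunctional (d : G.ClosedPath) (p₀ : G.InfPath) (ξ : G.TailClass) :
    ChenSpace K ξ →ₗ[K] K :=
  Finsupp.linearCombination K fun q : ξ.Mem => if PowMul d p₀ q.1 then 1 else 0

open scoped Classical in
omit [Fintype G.V] [Fintype G.E] in
theorem powMulFunctional_path (d : G.ClosedPath) (p₀ : G.InfPath) {ξ : G.TailClass} (q : ξ.Mem) :
    powMulFunctional K d p₀ ξ (path K q) = if PowMul d p₀ q.1 then 1 else 0 :=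
  (Finsupp.linearCombination_single K (1 : K) q).trans (one_smul K _)

/-- Prefixing `d` neither enters nor leaves the family `d^k p₀`, and paths killed by `d` start
elsewhere, hence lie outside it. So the functional vanishes on `(d - 1)T`. -/
theorem powMulFunctional_prod_smul {d : G.ClosedPath} {p₀ : G.InfPath} (hs : p₀.src = d.src)
    (h₀ : ¬ p₀.DivisibleBy d) {ξ : G.TailClass} (y : ChenSpace K ξ) :
    powMulFunctional K d p₀ ξ (d.prod K • y) = powMulFunctional K d p₀ ξ y := by
  classical
  induction y using ChenSpace.induction with
  | zero => rw [smul_zero]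
  | add a b ha hb => rw [smul_add, map_add, map_add, ha, hb]
  | smul_path k q =>
    rw [ChenSpace.smul_comm, (powMulFunctional K d p₀ ξ).map_smul,
      (powMulFunctional K d p₀ ξ).map_smul]
    congr 1
    by_cases h : G.s (d.inf.edge d.edges.length) = q.1.src
    · rw [ClosedPath.prod, prefixProd_smul _ _ _ h, powMulFunctional_path, powMulFunctional_path]
      exact if_congr (powMul_splice_iff h₀ q.1 h) rfl rfl
    · rw [ClosedPath.prod, prefixProd_smul_ne _ d.length_pos _ h, map_zero, powMulFunctional_path,
        if_neg]
      exact fun hq => h (d.inf_edge_length.trans (hq.src_eq hs).symm)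

theorem prod_smul_eq_zero {d : G.ClosedPath} {ξ : G.TailClass}
    (h : ∀ q : ξ.Mem, q.1.src ≠ d.src) (y : ChenSpace K ξ) : d.prod K • y = 0 := by
  induction y using ChenSpace.induction with
  | zero => rw [smul_zero]
  | add a b ha hb => rw [smul_add, ha, hb, add_zero]
  | smul_path k q =>
    rw [ChenSpace.smul_comm, ClosedPath.prod, prefixProd_smul_ne _ d.length_pos, smul_zero]
    rw [d.inf_edge_length]
    exact (h q).symm

theorem exists_src_eq_of_nontrivial_ext {d : G.ClosedPath} (hd : d.IsSimple) (ξ : G.TailClass)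
    (h : Nontrivial (Abelian.Ext (chenModule K d.chenClass) (chenModule K (.path ξ)) 1)) :
    ∃ q : ξ.Mem, q.1.src = d.src := by
  by_contra! hq
  refine not_subsingleton_iff_nontrivial.mpr h ?_
  refine subsingleton_ext_of_smul_surjective (ClosedPath.resolution_shortExact K hd)
    (ChenSpace K ξ) fun t => ⟨-t, ?_⟩
  rw [sub_smul, prod_smul_eq_zero hq, one_smul, zero_sub, neg_neg]

/-- The functionals attached to the members `p₀` vanish on `(d - 1)T` and are dual to the members
themselves, which are therefore independent modulo `(d - 1)T`. -/
theorem finite_LSet_of_finite_ext {d : G.ClosedPath} (hd : d.IsSimple) (q : G.InfPath)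
    (h : Module.Finite K
      (Abelian.Ext (chenModule K d.chenClass) (chenModule K (.path ⟦q⟧)) 1)) :
    (LSet d q).Finite := by
  classical
  have h' : Module.Finite K (Abelian.Ext
    (ModuleCat.of (LPA K G) (ChenSpace K (⟦d.inf⟧ : G.TailClass)))
    (ModuleCat.of (LPA K G) (ChenSpace K (⟦q⟧ : G.TailClass))) 1) := h
  let t : LSet d q → ChenSpace K (⟦q⟧ : G.TailClass) := fun p =>
    path K ⟨p.1, Quotient.sound p.2.1⟩
  refine Set.finite_coe_iff.mp ?_
  refine finite_of_finite_ext (K := K) (ClosedPath.resolution_shortExact K hd)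
    (ChenSpace K (⟦q⟧ : G.TailClass)) t fun c s hc => ?_
  ext p₀
  have h1 := congrArg (powMulFunctional K d p₀.1 ⟦q⟧) hc
  rw [sub_smul, one_smul, map_sub, powMulFunctional_prod_smul p₀.2.2.1 p₀.2.2.2, sub_self,
    map_finsuppSum] at h1
  have h2 : ∀ p ∈ c.support, p ≠ p₀ →
      powMulFunctional K d p₀.1 ⟦q⟧ (algebraMap K (LPA K G) (c p) • t p) = 0 := by
    intro p _ hp
    rw [ChenSpace.algebraMap_smul, map_smul, powMulFunctional_path, if_neg, smul_zero]
    exact fun hpow => hp (Subtype.ext (hpow.eq_of_not_divisibleBy p.2.2.2))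
  rw [Finsupp.sum, Finset.sum_eq_single p₀ h2] at h1
  · rwa [ChenSpace.algebraMap_smul, map_smul, powMulFunctional_path, if_pos PowMul.base,
      smul_eq_mul, mul_one] at h1
  · intro hp
    rw [Finsupp.notMem_support_iff.mp hp, map_zero, zero_smul, map_zero]

end Leavitt

end DirectedGraph

theorem mainTheorem11 {K : Type u} [Field K] (G : DirectedGraph.{v}) [Fintype G.V] [Fintype G.E]
    (d : G.ClosedPath) (hd : d.IsSimple) :
    (∀ T : G.ChenClass,
      Module.Finite K
        (Abelian.Ext (DirectedGraph.chenModule K d.chenClass) (DirectedGraph.chenModule K T) 1) →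
      Nontrivial
        (Abelian.Ext (DirectedGraph.chenModule K d.chenClass) (DirectedGraph.chenModule K T) 1) →
      (∃ c : G.ClosedPath, c.IsSimple ∧ T = c.chenClass) ∨
        (∃ (w : G.V) (hw : G.IsSink w), T = .sink w hw)) ∧
    (∀ q : G.InfPath, ¬ q.IsRational → (DirectedGraph.LSet d q).Nonempty →
      (DirectedGraph.LSet d q).Infinite) ∧
    ((DirectedGraph.LSet d d.inf).Nonempty → (DirectedGraph.LSet d d.inf).Infinite) := by
  refine ⟨fun T hfin hnt => ?_, fun q hq => DirectedGraph.LSet_infinite_of_not_isRational hq,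
    DirectedGraph.LSet_inf_infinite⟩
  cases T with
  | sink w hw => exact Or.inr ⟨w, hw, rfl⟩
  | path ξ =>
    obtain ⟨q, rfl⟩ := Quotient.exists_rep ξ
    left
    have hq : q.IsRational := by
      by_contra hq
      obtain ⟨p, hp⟩ := DirectedGraph.exists_src_eq_of_nontrivial_ext hd _ hnt
      exact DirectedGraph.LSet_infinite_of_not_isRational hq
        (DirectedGraph.LSet_nonempty hq (Quotient.exact p.2) hp)
        (DirectedGraph.finite_LSet_of_finite_ext hd q hfin)
    obtain ⟨c, hc⟩ := hq
    -- Rationality supplies an arbitrary closed path; a simple one with the same infinite power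
    -- replaces it.
    obtain ⟨b, hb, hbc⟩ := c.exists_isSimple
    refine ⟨b, hb, congrArg DirectedGraph.ChenClass.path (Quotient.sound ?_)⟩
    rw [hbc]
    exact hc
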